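/- Let $G=(V,E)$ be a finite connected simple graph with a fixed plane embedding; "face" means bounded face. Let $M_G$ be the group generated by the central phases $\pm1,\pm i$, the vertices $v$ and the directed edges $e_{ij}$ of $G$, subject to $e_{ij}^2=v_j^2=1$, $e_{ij}=-e_{ji}$, $v_iv_j=v_jv_i$, where an edge and a vertex anticommute if they are incident and commute otherwise, and two edges anticommute if they share exactly one vertex and commute if they share none. Let $\mathcal C_G\le M_G$ be the cycle group, consisting of the elements $i^{n}\,e_{i_0i_1}e_{i_1i_2}\cdots e_{i_{n-1}i_0}$ of the closed walks of $G$ with $n$ edges. A fermionic encoding is a representation $\sigma$ of $M_G$ on the Hilbert space of $N$ qubits, with phases acting as scalars and with values in the Pauli group, such that $-1\notin\sigma(\mathcal C_G)$. With $M=|V|$ modes, stabilizer group $S=\sigma(\mathcal C_G)$, and $D(S)$ the least number of generators of $S$, its disparity is $\Delta=N-M-D(S)$. Let $K=\ker(\sigma|_{\mathcal C_G})$. A Weight-3 planar encoding is a fermionic encoding whose qubits are one vertex qubit for every vertex together with auxiliary qubits, each auxiliary qubit being associated with a face and each face with at most one auxiliary qubit, such that (up to phases) $\sigma(v)$ is a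 Pauli $Z$ on the vertex qubit of $v$, and $\sigma(e_{ij})$ is the product of a Pauli $X$ or $Y$ on each of the two vertex qubits of $i$ and $j$ and of a Pauli $X$, $Y$ or $Z$ on at most one auxiliary qubit, whose face is adjacent to the edge. Suppose that every face carrying an auxiliary qubit is bounded by a cycle, that is, the edges having this face on exactly one side are the edges of a simple cycle of $G$. Then the disparity of the Weight-3 planar encoding is $$\Delta = F_K - EF,$$ where $F_K$ is the number of faces whose face cycle (the element of $\mathcal C_G$ given by the closed boundary walk of the face) lies in $K$, and $EF$ is the number of faces without an auxiliary qubit. -/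

import Mathlib

namespace FermionicEncoding

/-! ### Multi-qubit Pauli operators -/

/-- The labels of the four single-qubit Pauli operators. -/
inductive Pauli
  | I
  | X
  | Y
  | Z
  deriving DecidableEq

instance : Finite Pauli :=
  Finite.of_surjective (![Pauli.I, Pauli.X, Pauli.Y, Pauli.Z]) fun p => by
    cases p
    exacts [⟨0, rfl⟩, ⟨1, rfl⟩, ⟨2, rfl⟩, ⟨3, rfl⟩]

/-- The `2 × 2` matrix of a single-qubit Pauli operator. -/
noncomputable def Pauli.mat : Pauli → Matrix (Fin 2) (Fin 2) ℂ
  | .I => 1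
  | .X => !![0, 1; 1, 0]
  | .Y => !![0, -Complex.I; Complex.I, 0]
  | .Z => !![1, 0; 0, -1]

/-- Operators on the Hilbert space `(ℂ²)^{⊗ Q}` of a finite set `Q` of qubits, written as matrices
in the computational basis, whose elements are the bit assignments `Q → Fin 2`. -/
abbrev QubitOp (Q : Type*) : Type _ := Matrix (Q → Fin 2) (Q → Fin 2) ℂ

/-- The tensor product over all qubits `q` of the single-qubit Pauli operators `P q`. -/
noncomputable def pauliString {Q : Type*} [Fintype Q] (P : Q → Pauli) : QubitOp Q :=
  Matrix.of fun x y => ∏ q, (P q).mat (x q) (y q)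

/-- The scalar `i ^ k`, for `k` modulo `4`. -/
noncomputable def iPow (k : ZMod 4) : ℂ := Complex.I ^ k.val

/-- `U` belongs to the multi-qubit Pauli group `{±1, ±i} × {I, X, Y, Z}^Q`. -/
def IsPauliOp {Q : Type*} [Fintype Q] (U : QubitOp Q) : Prop :=
  ∃ (k : ZMod 4) (P : Q → Pauli), U = iPow k • pauliString P

/-! ### The group `M_G` of a graph and its cycle subgroup -/

/-- Generators of `M_G`: the phases (`phase k` stands for `i ^ k`), the vertices, and the directed
edges of `G`. -/
inductive Gen {V : Type*} (G : SimpleGraph V)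
  | phase (k : ZMod 4)
  | vertex (v : V)
  | edge (d : G.Dart)

/-- The defining relations of `M_G`: `Rel G a b` says that the words `a` and `b` are identified.
The first three say that the phases form a central copy of `{1, i, -1, -i}`; `phase 2` is `-1`. -/
inductive Rel {V : Type*} (G : SimpleGraph V) : FreeGroup (Gen G) → FreeGroup (Gen G) → Prop
  | phase_mul (a b : ZMod 4) :
      Rel G (.of (.phase a) * .of (.phase b)) (.of (.phase (a + b)))
  | phase_vertex (a : ZMod 4) (v : V) :
      Rel G (.of (.phase a) * .of (.vertex v)) (.of (.vertex v) * .of (.phase a))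
  | phase_edge (a : ZMod 4) (d : G.Dart) :
      Rel G (.of (.phase a) * .of (.edge d)) (.of (.edge d) * .of (.phase a))
  | edge_sq (d : G.Dart) :
      Rel G (.of (.edge d) * .of (.edge d)) 1
  | vertex_sq (v : V) :
      Rel G (.of (.vertex v) * .of (.vertex v)) 1
  | edge_symm (d : G.Dart) :
      Rel G (.of (.edge d)) (.of (.phase 2) * .of (.edge d.symm))
  | vertex_comm (v w : V) :
      Rel G (.of (.vertex v) * .of (.vertex w)) (.of (.vertex w) * .of (.vertex v))
  | edge_vertex_comm (d : G.Dart) (v : V) (h₁ : v ≠ d.fst) (h₂ : v ≠ d.snd) :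
      Rel G (.of (.edge d) * .of (.vertex v)) (.of (.vertex v) * .of (.edge d))
  | edge_edge_comm (d d' : G.Dart) (h₁ : d.fst ≠ d'.fst) (h₂ : d.fst ≠ d'.snd)
      (h₃ : d.snd ≠ d'.fst) (h₄ : d.snd ≠ d'.snd) :
      Rel G (.of (.edge d) * .of (.edge d')) (.of (.edge d') * .of (.edge d))
  | edge_vertex_anticomm (d : G.Dart) :
      Rel G (.of (.edge d) * .of (.vertex d.snd))
        (.of (.phase 2) * (.of (.vertex d.snd) * .of (.edge d)))
  | edge_edge_anticomm (d d' : G.Dart) (h₁ : d.snd = d'.fst) (h₂ : d.fst ≠ d'.snd) :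
      Rel G (.of (.edge d) * .of (.edge d'))
        (.of (.phase 2) * (.of (.edge d') * .of (.edge d)))

/-- The finitely presented group `M_G`. -/
abbrev MajoranaGroup {V : Type*} (G : SimpleGraph V) : Type _ :=
  PresentedGroup {r : FreeGroup (Gen G) | ∃ a b, Rel G a b ∧ r = a * b⁻¹}

/-- The image in `M_G` of a generator. -/
def gen {V : Type*} {G : SimpleGraph V} (x : Gen G) : MajoranaGroup G :=
  PresentedGroup.of x

/-- `i ^ n` times the product of the `n` directed edges in the list `l`. -/
def pathElt {V : Type*} {G : SimpleGraph V} (l : List G.Dart) : MajoranaGroup G :=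
  gen (.phase (l.length : ZMod 4)) * (l.map fun d => gen (.edge d)).prod

/-- The cycle group `C_G`: the subgroup of `M_G` generated by the elements of the closed walks of
`G`. (For connected `G` these elements already form a subgroup.) -/
def cycleGroup {V : Type*} (G : SimpleGraph V) : Subgroup (MajoranaGroup G) :=
  Subgroup.closure {c | ∃ (v : V) (w : G.Walk v v), c = pathElt w.darts}

/-! ### Fermionic encodings and their disparity -/

/-- A fermionic encoding of the graph `G` into the qubits `Q`: a representation `σ` of `M_G` on the
qubit Hilbert space, in which the phases act as scalars, taking values in the Pauli group, such that
no element of the cycle group is mapped to `-1`. -/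
structure Encoding {V : Type*} (G : SimpleGraph V) (Q : Type*) [Fintype Q] [DecidableEq Q] where
  σ : MajoranaGroup G →* (QubitOp Q)ˣ
  phase_op : ∀ k : ZMod 4, (σ (gen (.phase k)) : QubitOp Q) = iPow k • 1
  isPauliOp : ∀ m : MajoranaGroup G, IsPauliOp (σ m : QubitOp Q)
  neg_one_notMem : (-1 : (QubitOp Q)ˣ) ∉ (cycleGroup G).map σ

namespace Encoding

variable {V : Type*} {G : SimpleGraph V} {Q : Type*} [Fintype Q] [DecidableEq Q]

/-- The stabilizer group `S = σ(C_G)`. -/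
def stabilizer (ε : Encoding G Q) : Subgroup (QubitOp Q)ˣ := (cycleGroup G).map ε.σ

/-- `K`, the group of all cycles that are mapped to the identity under `σ`. -/
def kernel (ε : Encoding G Q) : Subgroup (MajoranaGroup G) := cycleGroup G ⊓ ε.σ.ker

/-- The stabilizer group is finite; so its rank (least number of generators) makes sense. -/
instance finite_stabilizer (ε : Encoding G Q) : Finite ε.stabilizer := by
  have hfin : (Set.range fun p : ZMod 4 × (Q → Pauli) => iPow p.1 • pauliString p.2).Finite :=
    Set.finite_range _
  have hpre : ((fun u : (QubitOp Q)ˣ => (u : QubitOp Q)) ⁻¹'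
      (Set.range fun p : ZMod 4 × (Q → Pauli) => iPow p.1 • pauliString p.2)).Finite :=
    hfin.preimage (Units.val_injective.injOn)
  refine (hpre.subset ?_).to_subtype
  rintro u ⟨m, -, rfl⟩
  obtain ⟨k, P, h⟩ := ε.isPauliOp m
  exact ⟨(k, P), h.symm⟩

/-- The disparity `Δ = N - M - D(S)`, where `N` is the number of qubits, `M` the number of modes
(vertices), and `D(S)` the least number of generators of the stabilizer group. -/
noncomputable def disparity [Fintype V] (ε : Encoding G Q) : ℤ :=
  (Fintype.card Q : ℤ) - Fintype.card V - Group.rank ε.stabilizer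

end Encoding

/-! ### Plane embeddings -/

/-- The face permutation of a rotation `rot` of the darts: go along the dart `d`, and leave its
endpoint along the dart that follows the reverse of `d` in the rotation at that vertex. -/
def facePerm {V : Type*} {G : SimpleGraph V} (rot : Equiv.Perm G.Dart) : Equiv.Perm G.Dart :=
  (SimpleGraph.Dart.symm_involutive (G := G)).toPerm.trans rot

/-- The faces of a rotation system: the orbits of the face permutation. A dart belongs to the orbit
of the face lying on a fixed side of it; its reverse belongs to the face on the other side. -/
def FaceOf {V : Type*} {G : SimpleGraph V} (rot : Equiv.Perm G.Dart) : Type _ :=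
  Quotient (Equiv.Perm.SameCycle.setoid (facePerm rot))

/-- The face on the fixed side of the dart `d`. -/
def faceOf {V : Type*} {G : SimpleGraph V} (rot : Equiv.Perm G.Dart) (d : G.Dart) : FaceOf rot :=
  Quotient.mk (Equiv.Perm.SameCycle.setoid (facePerm rot)) d

/-- A plane embedding of a connected graph, as a combinatorial map of genus zero: the cyclic order
`rot` of the darts leaving each vertex, and a choice of the unbounded face, such that Euler's formula
`|V| - |E| + |F| = 2` holds. A graph without edges (a single vertex) has only the unbounded face,
which has no darts around it; hence `F` is counted as the bounded faces plus one. -/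
structure PlaneEmbedding {V : Type*} [Fintype V] (G : SimpleGraph V) where
  rot : Equiv.Perm G.Dart
  fst_rot : ∀ d, (rot d).fst = d.fst
  sameCycle_rot : ∀ d d' : G.Dart, d.fst = d'.fst → rot.SameCycle d d'
  IsUnbounded : FaceOf rot → Prop
  existsUnique_isUnbounded : Nonempty G.Dart → ∃! f, IsUnbounded f
  euler : (Fintype.card V : ℤ) - Nat.card G.edgeSet + (Nat.card {f // ¬ IsUnbounded f} + 1) = 2

namespace PlaneEmbedding

variable {V : Type*} [Fintype V] {G : SimpleGraph V}

/-- The bounded faces; "face" means bounded face in what follows. -/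
def Face (Λ : PlaneEmbedding G) : Type _ := {f : FaceOf Λ.rot // ¬ Λ.IsUnbounded f}

/-- The face `f` lies on the fixed side of the dart `d`. -/
def Beside (Λ : PlaneEmbedding G) (d : G.Dart) (f : Λ.Face) : Prop := faceOf Λ.rot d = f.1

/-- The (undirected) edge of the dart `d` is adjacent to the face `f`. -/
def Adjacent (Λ : PlaneEmbedding G) (d : G.Dart) (f : Λ.Face) : Prop :=
  Λ.Beside d f ∨ Λ.Beside d.symm f

/-- The closed boundary walk of the face containing `d` on its fixed side, started at `d`. -/
noncomputable def boundaryWalk (Λ : PlaneEmbedding G) (d : G.Dart) : List G.Dart :=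
  (List.range (Function.minimalPeriod (facePerm Λ.rot) d)).map fun k => (facePerm Λ.rot)^[k] d

/-- The face cycle of `f`: the element of the cycle group given by the closed boundary walk of `f`.
(The starting point is immaterial, as the elements of the cycle group are central.) -/
noncomputable def faceCycle (Λ : PlaneEmbedding G) (f : Λ.Face) : MajoranaGroup G :=
  pathElt (Λ.boundaryWalk (Quotient.out f.1))

/-- The face `f` is bounded by a cycle: the edges with `f` on exactly one side are exactly the edges
of a simple cycle of `G`. -/
def BoundedByCycle (Λ : PlaneEmbedding G) (f : Λ.Face) : Prop :=
  ∃ (v : V) (p : G.Walk v v), p.IsCycle ∧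
    ∀ d : G.Dart, d.edge ∈ p.edges ↔ Xor (Λ.Beside d f) (Λ.Beside d.symm f)

end PlaneEmbedding

/-! ### Weight 3 planar encodings -/

/-- A Weight 3 planar encoding on the plane graph `Λ`, with auxiliary qubits `A`. The qubits are one
vertex qubit `Sum.inl v` for every vertex `v` and the auxiliary qubits `Sum.inr a`. Operators are
prescribed up to a phase. -/
structure Weight3PlanarEncoding {V : Type*} [Fintype V] [DecidableEq V] {G : SimpleGraph V}
    (Λ : PlaneEmbedding G) (A : Type*) [Fintype A] [DecidableEq A]
    extends Encoding G (V ⊕ A) where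
  /-- Every auxiliary qubit is associated with a unique face. -/
  face : A → Λ.Face
  /-- Every face is associated with at most one auxiliary qubit. -/
  face_injective : Function.Injective face
  /-- Every vertex operator is a Pauli `Z` on the vertex qubit. -/
  vertex_op : ∀ v : V, ∃ (k : ZMod 4) (P : V ⊕ A → Pauli),
    (σ (gen (.vertex v)) : QubitOp (V ⊕ A)) = iPow k • pauliString P ∧
    P (.inl v) = .Z ∧ ∀ q, q ≠ .inl v → P q = .I
  /-- Every edge operator is an `X` or `Y` on each of the two incident vertex qubits, and a
  non-identity Pauli on at most one auxiliary qubit, whose face is adjacent to the edge. -/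
  edge_op : ∀ d : G.Dart, ∃ (k : ZMod 4) (P : V ⊕ A → Pauli),
    (σ (gen (.edge d)) : QubitOp (V ⊕ A)) = iPow k • pauliString P ∧
    (P (.inl d.fst) = .X ∨ P (.inl d.fst) = .Y) ∧
    (P (.inl d.snd) = .X ∨ P (.inl d.snd) = .Y) ∧
    (∀ v, v ≠ d.fst → v ≠ d.snd → P (.inl v) = .I) ∧
    (∀ a, P (.inr a) ≠ .I → Λ.Adjacent d (face a)) ∧
    (∀ a b, P (.inr a) ≠ .I → P (.inr b) ≠ .I → a = b)

namespace Weight3PlanarEncoding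

variable {V : Type*} [Fintype V] [DecidableEq V] {G : SimpleGraph V} {Λ : PlaneEmbedding G}
  {A : Type*} [Fintype A] [DecidableEq A]

/-- `F_K`, the number of faces whose face cycle lies in `K`. -/
noncomputable def numFaceCyclesInKernel (ε : Weight3PlanarEncoding Λ A) : ℕ :=
  Nat.card {f : Λ.Face // Λ.faceCycle f ∈ ε.kernel}

/-- `EF`, the number of faces without an auxiliary qubit. -/
noncomputable def numEmptyFaces (ε : Weight3PlanarEncoding Λ A) : ℕ :=
  Nat.card {f : Λ.Face // f ∉ Set.range ε.face}

end Weight3PlanarEncoding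

end FermionicEncoding

namespace FermionicEncoding

/-! Up to phase, a Pauli operator is a vector over `ZMod 2`, and products become sums. Since no
cycle maps to `-1`, the stabilizer group embeds into these vectors (`stabilizerLabel_injective`), so
its rank is the dimension of its image. A closed walk has a mod 2 edge chain, its label is a linear
function `chainLabel` of that chain, and the chains of the bounded faces form a basis of the cycle
space: independence comes from connectedness and the unbounded face, spanning from Euler's formula
(`span_faceChain`). Hence the labels of the face cycles span the image.

The crux is that the only linear relations among these labels are the obvious ones: the face cycles
outside `K` have independent labels (`label_faceCycle_eq_zero`). Let `c` be a combination of face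
chains with label zero. Two edges meeting at a vertex anticommute, so if they carry the same letter
there they must share an auxiliary qubit (`exists_common_auxiliary`). Cutting `c` into the parts
`auxPart c a` acting on each auxiliary qubit `a` therefore keeps together the edges that cancel at a
vertex, and each part again has label zero (`chainLabel_auxPart`). In particular each part is a
cycle, and it lives on the simple cycle bounding the face of `a`, so it is zero or that face chain.
By independence of face chains, every face occurring in `c` is one of these, and its own label
vanishes.

So the rank is the number of faces minus `F_K`, while the number of auxiliary qubits is the number
of faces minus `EF`; subtracting gives the disparity. -/

/-! ### Phases and single-qubit Pauli operators. -/

theorem iPow_add (a b : ZMod 4) : iPow (a + b) = iPow a * iPow b := by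
  rw [iPow, iPow, iPow, ← pow_add, ZMod.val_add, ← Complex.I_pow_eq_pow_mod]

@[simp] theorem iPow_zero : iPow 0 = 1 := by simp [iPow]

theorem iPow_one : iPow 1 = Complex.I := by
  rw [iPow, ZMod.val_one'' (by decide), pow_one]

theorem iPow_two : iPow 2 = -1 := by
  rw [show (2 : ZMod 4) = 1 + 1 by decide, iPow_add, iPow_one, Complex.I_mul_I]

theorem iPow_three : iPow 3 = -Complex.I := by
  rw [show (3 : ZMod 4) = 2 + 1 by decide, iPow_add, iPow_one, iPow_two, neg_one_mul]

theorem iPow_ne_zero (k : ZMod 4) : iPow k ≠ 0 := pow_ne_zero _ Complex.I_ne_zero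

theorem iPow_sum {ι : Type*} (s : Finset ι) (k : ι → ZMod 4) :
    iPow (∑ i ∈ s, k i) = ∏ i ∈ s, iPow (k i) := by
  classical
  induction s using Finset.induction_on with
  | empty => simp
  | insert a s ha ih => rw [Finset.sum_insert ha, Finset.prod_insert ha, iPow_add, ih]

theorem _root_.ZMod.eq_one_of_ne_zero {x : ZMod 2} (h : x ≠ 0) : x = 1 := by
  revert x; decide

/-- The symplectic coordinates of a single-qubit Pauli operator up to phase. -/
def Pauli.vec : Pauli → ZMod 2 × ZMod 2
  | .I => (0, 0)
  | .X => (1, 0)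
  | .Y => (1, 1)
  | .Z => (0, 1)

theorem Pauli.vec_injective : Function.Injective Pauli.vec := by
  intro p q; cases p <;> cases q <;> decide

theorem Pauli.vec_eq_zero {p : Pauli} : p.vec = 0 ↔ p = .I :=
  ⟨fun h => vec_injective (h.trans rfl), fun h => h ▸ rfl⟩

/-- The symplectic form on the coordinates of one qubit. -/
def qubitForm (x y : ZMod 2 × ZMod 2) : ZMod 2 := x.1 * y.2 + x.2 * y.1

theorem Pauli.mat_mul_mat (p q : Pauli) :
    ∃ (k : ZMod 4) (r : Pauli), p.mat * q.mat = iPow k • r.mat ∧ r.vec = p.vec + q.vec := by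
  cases p <;> cases q
  · exact ⟨0, .I, by simp [mat], by decide⟩
  · exact ⟨0, .X, by simp [mat], by decide⟩
  · exact ⟨0, .Y, by simp [mat], by decide⟩
  · exact ⟨0, .Z, by simp [mat], by decide⟩
  · exact ⟨0, .X, by simp [mat], by decide⟩
  · exact ⟨0, .I, by simp [mat, Matrix.one_fin_two], by decide⟩
  · exact ⟨1, .Z, by simp [mat, iPow_one], by decide⟩
  · exact ⟨3, .Y, by simp [mat, iPow_three], by decide⟩
  · exact ⟨0, .Y, by simp [mat], by decide⟩
  · exact ⟨3, .Z, by simp [mat, iPow_three], by decide⟩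
  · exact ⟨0, .I, by simp [mat, Matrix.one_fin_two], by decide⟩
  · exact ⟨1, .X, by simp [mat, iPow_one], by decide⟩
  · exact ⟨0, .Z, by simp [mat], by decide⟩
  · exact ⟨1, .Y, by simp [mat, iPow_one], by decide⟩
  · exact ⟨3, .X, by simp [mat, iPow_three], by decide⟩
  · exact ⟨0, .I, by simp [mat, Matrix.one_fin_two], by decide⟩

theorem Pauli.mat_mul_comm (p q : Pauli) (h : qubitForm p.vec q.vec = 0) :
    p.mat * q.mat = q.mat * p.mat := by
  cases p <;> cases q <;> first | exact absurd h (by decide) | simp [mat]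

theorem Pauli.mat_mul_anticomm (p q : Pauli) (h : qubitForm p.vec q.vec ≠ 0) :
    p.mat * q.mat = -(q.mat * p.mat) := by
  cases p <;> cases q <;> first | exact absurd (by decide) h | simp [mat]

theorem Pauli.trace_mat {p : Pauli} (h : p ≠ .I) : p.mat.trace = 0 := by
  cases p <;> simp_all [mat, Matrix.trace_fin_two]

/-! ### Pauli strings and their symplectic coordinates. -/

section Tensor

variable {Q : Type*} [Fintype Q]

/-- The tensor product of a family of `2 × 2` matrices. -/
def qubitTensor (A : Q → Matrix (Fin 2) (Fin 2) ℂ) : QubitOp Q :=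
  Matrix.of fun x y => ∏ q, A q (x q) (y q)

theorem pauliString_eq (P : Q → Pauli) : pauliString P = qubitTensor fun q => (P q).mat := rfl

theorem qubitTensor_mul [DecidableEq Q] (A B : Q → Matrix (Fin 2) (Fin 2) ℂ) :
    qubitTensor A * qubitTensor B = qubitTensor fun q => A q * B q := by
  ext x y
  simp only [qubitTensor, Matrix.mul_apply, Matrix.of_apply, ← Finset.prod_mul_distrib]
  rw [Finset.prod_univ_sum, Fintype.piFinset_univ]

theorem pauliString_one : pauliString (fun _ : Q => Pauli.I) = 1 := by
  ext x y
  rw [pauliString, Matrix.of_apply, Matrix.one_apply]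
  simp only [Pauli.mat, Matrix.one_apply]
  rw [Finset.prod_ite_zero]
  simp [funext_iff]

theorem qubitTensor_smul (s : Q → ℂ) (A : Q → Matrix (Fin 2) (Fin 2) ℂ) :
    qubitTensor (fun q => s q • A q) = (∏ q, s q) • qubitTensor A := by
  ext x y
  simp [qubitTensor, Finset.prod_mul_distrib]

theorem trace_qubitTensor [DecidableEq Q] (A : Q → Matrix (Fin 2) (Fin 2) ℂ) :
    (qubitTensor A).trace = ∏ q, (A q).trace := by
  simp only [qubitTensor, Matrix.trace, Matrix.diag, Matrix.of_apply]
  rw [Finset.prod_univ_sum, Fintype.piFinset_univ]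

variable [DecidableEq Q]

theorem pauliString_mul (P R : Q → Pauli) : ∃ (k : ZMod 4) (T : Q → Pauli),
    pauliString P * pauliString R = iPow k • pauliString T ∧
      ∀ q, (T q).vec = (P q).vec + (R q).vec := by
  choose k T h h' using fun q => (P q).mat_mul_mat (R q)
  exact ⟨∑ q, k q, T, by
    simp only [pauliString_eq, qubitTensor_mul, h, qubitTensor_smul, iPow_sum], h'⟩

theorem pauliString_mul_comm (P R : Q → Pauli)
    (h : ∑ q, qubitForm (P q).vec (R q).vec = 0) :
    pauliString P * pauliString R = pauliString R * pauliString P := by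
  have key : ∀ q, (P q).mat * (R q).mat =
      ((-1 : ℂ) ^ (qubitForm (P q).vec (R q).vec).val) • ((R q).mat * (P q).mat) := by
    intro q
    by_cases hq : qubitForm (P q).vec (R q).vec = 0
    · simp [hq, Pauli.mat_mul_comm _ _ hq]
    · rw [Pauli.mat_mul_anticomm _ _ hq, ZMod.eq_one_of_ne_zero hq]
      simp [ZMod.val_one]
  have hs : ∀ s : Finset Q, ∏ q ∈ s, (-1 : ℂ) ^ (qubitForm (P q).vec (R q).vec).val =
      (-1 : ℂ) ^ (∑ q ∈ s, qubitForm (P q).vec (R q).vec).val := by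
    intro s
    induction s using Finset.induction_on with
    | empty => simp
    | insert a s ha ih =>
      rw [Finset.prod_insert ha, Finset.sum_insert ha, ih, ← pow_add, ZMod.val_add,
        ← neg_one_pow_eq_pow_mod_two]
  simp only [pauliString_eq, qubitTensor_mul, key, qubitTensor_smul, hs, h]
  simp

/-- The trace is multiplicative over tensor factors and kills every letter except `I`, whereas a
nonzero scalar matrix has nonzero trace. -/
theorem eq_I_of_smul_pauliString_eq {a b : ℂ} {P : Q → Pauli}
    (h : a • pauliString P = b • 1) (hb : b ≠ 0) : ∀ q, P q = .I := by
  by_contra! hq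
  obtain ⟨q, hq⟩ := hq
  have := congrArg Matrix.trace h
  rw [Matrix.trace_smul, Matrix.trace_smul, pauliString_eq, trace_qubitTensor,
    Finset.prod_eq_zero (Finset.mem_univ q) (Pauli.trace_mat hq), Matrix.trace_one] at this
  simp [hb] at this

/-- The symplectic coordinates of Pauli operators on the qubits `Q` up to phase. -/
abbrev PauliVec (Q : Type*) : Type _ := Q → ZMod 2 × ZMod 2

/-- Multiplying both sides by `R` makes the right side scalar, so the string of `P * R` is trivial
and the coordinates of `P` and `R` agree. This makes `pauliLabel` independent of the chosen
presentation. -/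
theorem vec_eq_of_smul_pauliString_eq {k l : ZMod 4} {P R : Q → Pauli}
    (h : iPow k • pauliString P = iPow l • pauliString R) :
    (fun q => (P q).vec) = fun q => (R q).vec := by
  obtain ⟨m, T, hT, hv⟩ := pauliString_mul P R
  obtain ⟨n, T', hT', hv'⟩ := pauliString_mul R R
  have hI : ∀ q, T' q = .I := fun q => Pauli.vec_eq_zero.1 (by rw [hv', CharTwo.add_self_eq_zero])
  have hT1 : pauliString T' = 1 := by rw [funext hI, pauliString_one]
  have h2 : (iPow k * iPow m) • pauliString T = (iPow l * iPow n) • 1 := by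
    have := congrArg (· * pauliString R) h
    simpa only [smul_mul_assoc, hT, hT', smul_smul, hT1] using this
  have h3 := eq_I_of_smul_pauliString_eq h2
    (mul_ne_zero (iPow_ne_zero _) (iPow_ne_zero _))
  funext q
  have := hv q
  rw [h3 q, show Pauli.I.vec = 0 from rfl] at this
  exact CharTwo.add_eq_zero.1 this.symm

open Classical in
/-- The symplectic coordinates of a Pauli operator (zero for all other operators). -/
noncomputable def pauliLabel (U : QubitOp Q) : PauliVec Q :=
  if h : IsPauliOp U then fun q => (h.choose_spec.choose q).vec else 0

theorem pauliLabel_smul (k : ZMod 4) (P : Q → Pauli) :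
    pauliLabel (iPow k • pauliString P) = fun q => (P q).vec := by
  have h : IsPauliOp (iPow k • pauliString P) := ⟨k, P, rfl⟩
  rw [pauliLabel, dif_pos h]
  exact vec_eq_of_smul_pauliString_eq h.choose_spec.choose_spec.symm

theorem pauliLabel_mul {U U' : QubitOp Q} (h : IsPauliOp U) (h' : IsPauliOp U') :
    pauliLabel (U * U') = pauliLabel U + pauliLabel U' := by
  obtain ⟨k, P, rfl⟩ := h
  obtain ⟨l, R, rfl⟩ := h'
  obtain ⟨m, T, hT, hv⟩ := pauliString_mul P R
  rw [smul_mul_smul_comm, hT, smul_smul, ← iPow_add, ← iPow_add, pauliLabel_smul, pauliLabel_smul,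
    pauliLabel_smul]
  exact funext hv

theorem pauliLabel_iPow_smul_one (k : ZMod 4) : pauliLabel (iPow k • (1 : QubitOp Q)) = 0 := by
  rw [← pauliString_one, pauliLabel_smul]; rfl

theorem IsPauliOp.exists_eq_smul_one {U : QubitOp Q} (h : IsPauliOp U) (h0 : pauliLabel U = 0) :
    ∃ k : ZMod 4, U = iPow k • 1 := by
  obtain ⟨k, P, rfl⟩ := h
  rw [pauliLabel_smul] at h0
  have : P = fun _ => .I := funext fun q => Pauli.vec_eq_zero.1 (congrFun h0 q)
  exact ⟨k, by rw [this, pauliString_one]⟩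

theorem IsPauliOp.mul_comm {U U' : QubitOp Q} (h : IsPauliOp U) (h' : IsPauliOp U')
    (h0 : ∑ q, qubitForm (pauliLabel U q) (pauliLabel U' q) = 0) : U * U' = U' * U := by
  obtain ⟨k, P, rfl⟩ := h
  obtain ⟨l, R, rfl⟩ := h'
  rw [pauliLabel_smul, pauliLabel_smul] at h0
  rw [smul_mul_smul_comm, smul_mul_smul_comm, pauliString_mul_comm P R h0, _root_.mul_comm]

end Tensor


/-! ### Mod 2 edge chains and the cycle space. -/

section Chains

variable {V : Type*} {G : SimpleGraph V}

/-- The edge of a dart, as an element of the edge set. -/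
def dartEdge (d : G.Dart) : G.edgeSet := ⟨d.edge, d.edge_mem⟩

theorem exists_dartEdge_eq (e : G.edgeSet) : ∃ d : G.Dart, dartEdge d = e := by
  obtain ⟨e, he⟩ := e
  induction e using Sym2.ind with
  | _ x y => exact ⟨⟨(x, y), he⟩, rfl⟩

@[simp] theorem dartEdge_symm (d : G.Dart) : dartEdge d.symm = dartEdge d :=
  Subtype.ext d.edge_symm

theorem dartEdge_eq_iff {d d' : G.Dart} : dartEdge d = dartEdge d' ↔ d = d' ∨ d = d'.symm :=
  Subtype.ext_iff.trans (SimpleGraph.dart_edge_eq_iff d d')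

theorem mem_dartEdge {d : G.Dart} {v : V} : v ∈ (dartEdge d).1 ↔ v = d.fst ∨ v = d.snd :=
  Sym2.mem_iff

variable [DecidableEq V]

/-- The mod 2 edge chain of a dart. -/
def dartChain (d : G.Dart) : G.edgeSet → ZMod 2 := Pi.single (dartEdge d) 1

/-- The mod 2 edge chain of a list of darts. -/
def listChain (l : List G.Dart) : G.edgeSet → ZMod 2 := (l.map dartChain).sum

open Classical in
-- An edge is traversed at most once in each direction; traversals in both directions cancel.
theorem listChain_dartEdge {l : List G.Dart} (hl : l.Nodup) (d : G.Dart) :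
    listChain l (dartEdge d) = (if d ∈ l then 1 else 0) + if d.symm ∈ l then 1 else 0 := by
  induction l with
  | nil => simp [listChain]
  | cons a l ih =>
    rw [List.nodup_cons] at hl
    have hne : d ≠ d.symm := d.symm_ne.symm
    have : listChain (a :: l) (dartEdge d) = dartChain a (dartEdge d) + listChain l (dartEdge d) := by
      simp [listChain]
    rw [this, ih hl.2, dartChain, Pi.single_apply]
    simp only [List.mem_cons, dartEdge_eq_iff]
    by_cases h1 : d = a
    · subst h1
      simp [hl.1, hne.symm]
    · by_cases h2 : d = a.symm
      · subst h2
        simp only [SimpleGraph.Dart.symm_symm] at hne ⊢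
        simp [hl.1, hne, add_comm]
      · have h3 : d.symm ≠ a := fun h => h2 (by rw [← h, SimpleGraph.Dart.symm_symm])
        simp [h1, h2, h3]

variable [Fintype G.edgeSet]

/-- The mod 2 boundary map from edge chains to vertex chains. -/
def bdry (G : SimpleGraph V) [Fintype G.edgeSet] :
    (G.edgeSet → ZMod 2) →ₗ[ZMod 2] (V → ZMod 2) :=
  Fintype.linearCombination (ZMod 2) fun e v => if v ∈ e.1 then 1 else 0

theorem bdry_apply (u : G.edgeSet → ZMod 2) (v : V) :
    bdry G u v = ∑ e, u e * if v ∈ e.1 then 1 else 0 := by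
  simp [bdry, Fintype.linearCombination_apply]

theorem bdry_dartChain (d : G.Dart) :
    bdry G (dartChain d) = Pi.single d.fst 1 + Pi.single d.snd 1 := by
  funext v
  have hne := d.adj.ne
  rw [bdry_apply, Finset.sum_eq_single (dartEdge d)]
  · rw [dartChain, Pi.single_eq_same, one_mul, Pi.add_apply, Pi.single_apply, Pi.single_apply]
    simp only [mem_dartEdge]
    by_cases h : v = d.fst
    · subst h; simp [hne]
    · simp [h]
  · intro e _ he
    rw [dartChain, Pi.single_eq_of_ne he, zero_mul]
  · simp

theorem bdry_listChain_darts {u v : V} (w : G.Walk u v) :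
    bdry G (listChain w.darts) = Pi.single u 1 + Pi.single v 1 := by
  induction w with
  | nil => simp [listChain, ZModModule.add_self]
  | @cons a b c h p ih =>
    rw [SimpleGraph.Walk.darts_cons, listChain, List.map_cons, List.sum_cons, map_add,
      bdry_dartChain]
    rw [listChain] at ih
    rw [ih]
    change Pi.single a 1 + Pi.single b 1 + _ = _
    rw [add_assoc, ← add_assoc (Pi.single b 1), ZModModule.add_self, zero_add]

/-- A walk from any vertex to `v₀` shows that the boundaries together with the point mass at `v₀`
span all vertex chains, so the boundary map has rank at least `|V| - 1`. -/
theorem finrank_ker_bdry_add_le [Fintype V] (hG : G.Connected) :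
    Module.finrank (ZMod 2) (LinearMap.ker (bdry G)) + Fintype.card V ≤
      Fintype.card G.edgeSet + 1 := by
  obtain ⟨v₀⟩ := hG.nonempty
  have hrn := (bdry G).finrank_range_add_finrank_ker
  rw [Module.finrank_fintype_fun_eq_card] at hrn
  have htop : LinearMap.range (bdry G) ⊔ Submodule.span (ZMod 2) {Pi.single v₀ 1} = ⊤ := by
    rw [eq_top_iff, ← (Pi.basisFun (ZMod 2) V).span_eq, Submodule.span_le]
    rintro _ ⟨v, rfl⟩
    obtain ⟨w⟩ := hG.preconnected v v₀
    rw [Pi.basisFun_apply]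
    refine Submodule.mem_sup.2 ⟨_, ⟨listChain w.darts, rfl⟩, _,
      Submodule.mem_span_singleton_self _, ?_⟩
    rw [bdry_listChain_darts, add_assoc, ZModModule.add_self, add_zero]
  have h1 := Submodule.finrank_add_le_finrank_add_finrank (LinearMap.range (bdry G))
    (Submodule.span (ZMod 2) {(Pi.single v₀ 1 : V → ZMod 2)})
  have h2 := finrank_span_le_card (R := ZMod 2) ({Pi.single v₀ 1} : Set (V → ZMod 2))
  rw [htop, finrank_top, Module.finrank_fintype_fun_eq_card] at h1
  simp only [Set.toFinset_singleton, Finset.card_singleton] at h2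
  omega

/-- The initial vertex of a path lies on its first edge only, so the boundary there forces that
coefficient to vanish; the rest of the path follows by induction. -/
theorem eq_zero_of_support_path {a b : V} (p : G.Walk a b) (hp : p.IsPath)
    (u : G.edgeSet → ZMod 2) (hu : ∀ e, u e ≠ 0 → e.1 ∈ p.edges) (h0 : bdry G u = 0) :
    u = 0 := by
  induction p with
  | nil => exact funext fun e => by_contra fun h => by simpa using hu e h
  | @cons a b c h p ih =>
    rw [SimpleGraph.Walk.cons_isPath_iff] at hp
    refine ih hp.1 fun e he => ?_
    have := hu e he
    rw [SimpleGraph.Walk.edges_cons, List.mem_cons] at this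
    refine this.resolve_left fun heq => he ?_
    have hb := congrFun h0 a
    rw [bdry_apply, Finset.sum_eq_single e, heq, if_pos (Sym2.mem_mk_left _ _), mul_one] at hb
    · exact hb
    · intro e' _ hne
      rw [mul_ite, mul_one, mul_zero, ite_eq_right_iff]
      intro hae
      by_contra hue
      have := hu e' hue
      rw [SimpleGraph.Walk.edges_cons, List.mem_cons, ← heq] at this
      rcases this with h' | h'
      · exact hne (Subtype.ext h')
      · exact hp.2 (p.mem_support_of_mem_edges h' hae)
    · simp

theorem exists_eq_smul_of_support_cycle {a : V} (p : G.Walk a a) (hp : p.IsCycle)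
    {u b : G.edgeSet → ZMod 2} (hu : ∀ e, u e ≠ 0 → e.1 ∈ p.edges)
    (hb : ∀ e, b e ≠ 0 ↔ e.1 ∈ p.edges) (hu0 : bdry G u = 0) (hb0 : bdry G b = 0) :
    ∃ s : ZMod 2, u = s • b := by
  cases p with
  | nil => exact absurd hp (by simp)
  | @cons a v c h p =>
    rw [SimpleGraph.Walk.cons_isCycle_iff] at hp
    -- As `b` is 1 on the first edge, this multiple of `b` clears that edge from `u`; the remaining
    -- edges of the cycle form a path.
    refine ⟨u ⟨s(a, v), h⟩, sub_eq_zero.1 (eq_zero_of_support_path p hp.1 _ ?_ ?_)⟩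
    · intro e he
      by_cases heq : e = ⟨s(a, v), h⟩
      · have h1 : b e = 1 := ZMod.eq_one_of_ne_zero ((hb e).2 (by simp [heq]))
        refine absurd ?_ he
        rw [Pi.sub_apply, Pi.smul_apply, h1, smul_eq_mul, mul_one, heq, sub_self]
      · have hmem : e.1 ∈ (SimpleGraph.Walk.cons h p).edges := by
          by_contra hn
          have h1 : u e = 0 := by_contra fun hh => hn (hu e hh)
          have h2 : b e = 0 := by_contra fun hh => hn ((hb e).1 hh)
          exact he (by simp [h1, h2])
        rw [SimpleGraph.Walk.edges_cons, List.mem_cons] at hmem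
        exact hmem.resolve_left fun hh => heq (Subtype.ext hh)
    · rw [map_sub, map_smul, hu0, hb0, smul_zero, sub_zero]

end Chains

/-! ### Face chains of a plane embedding form a basis of the cycle space. -/

section Faces

variable {V : Type*} {G : SimpleGraph V}

theorem facePerm_apply (rot : Equiv.Perm G.Dart) (d : G.Dart) :
    facePerm rot d = rot d.symm := rfl

theorem faceOf_eq_iff {rot : Equiv.Perm G.Dart} {d d' : G.Dart} :
    faceOf rot d = faceOf rot d' ↔ (facePerm rot).SameCycle d d' :=
  Quotient.eq (r := Equiv.Perm.SameCycle.setoid (facePerm rot))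

theorem faceOf_facePerm (rot : Equiv.Perm G.Dart) (d : G.Dart) :
    faceOf rot (facePerm rot d) = faceOf rot d :=
  faceOf_eq_iff.2 (Equiv.Perm.sameCycle_apply_left.2 (Equiv.Perm.SameCycle.refl _ _))

theorem exists_faceOf_eq {rot : Equiv.Perm G.Dart} (f : FaceOf rot) : ∃ d, faceOf rot d = f :=
  Quotient.exists_rep f

instance finite_dart [Finite V] : Finite G.Dart :=
  Finite.of_injective _ SimpleGraph.Dart.toProd_injective

variable [Fintype V] (Λ : PlaneEmbedding G)

namespace PlaneEmbedding

theorem exists_walk_iterate (d : G.Dart) (n : ℕ) :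
    ∃ w : G.Walk d.fst ((facePerm Λ.rot)^[n] d).fst,
      w.darts = (List.range n).map fun k => (facePerm Λ.rot)^[k] d := by
  induction n with
  | zero => exact ⟨.nil, rfl⟩
  | succ n ih =>
    obtain ⟨w, hw⟩ := ih
    have hfst : ((facePerm Λ.rot)^[n + 1] d).fst = ((facePerm Λ.rot)^[n] d).snd := by
      rw [Function.iterate_succ_apply', facePerm_apply, Λ.fst_rot]; rfl
    rw [hfst]
    refine ⟨w.concat ((facePerm Λ.rot)^[n] d).adj, ?_⟩
    rw [SimpleGraph.Walk.darts_concat, hw, List.range_succ, List.map_append]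
    simp

theorem exists_walk_darts_eq_boundaryWalk (d : G.Dart) :
    ∃ w : G.Walk d.fst d.fst, w.darts = Λ.boundaryWalk d := by
  have := Λ.exists_walk_iterate d (Function.minimalPeriod (facePerm Λ.rot) d)
  rwa [Function.iterate_minimalPeriod] at this

theorem nodup_boundaryWalk (d : G.Dart) : (Λ.boundaryWalk d).Nodup := by
  refine List.Nodup.map_on ?_ List.nodup_range
  intro x hx y hy h
  rw [List.mem_range] at hx hy
  exact Function.iterate_injOn_Iio_minimalPeriod hx hy h

theorem mem_boundaryWalk {d d' : G.Dart} :
    d' ∈ Λ.boundaryWalk d ↔ faceOf Λ.rot d' = faceOf Λ.rot d := by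
  classical
  rw [eq_comm, faceOf_eq_iff, boundaryWalk, List.mem_map]
  constructor
  · rintro ⟨k, -, rfl⟩
    exact ⟨k, by rw [zpow_natCast, Equiv.Perm.iterate_eq_pow]⟩
  · intro h
    obtain ⟨k, hk⟩ := h.exists_nat_pow_eq
    have hpos : 0 < Function.minimalPeriod (facePerm Λ.rot) d :=
      Function.minimalPeriod_pos_of_mem_periodicPts
        ((facePerm Λ.rot).injective.mem_periodicPts d)
    refine ⟨k % Function.minimalPeriod (facePerm Λ.rot) d, List.mem_range.2 (Nat.mod_lt _ hpos), ?_⟩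
    rw [Function.iterate_mod_minimalPeriod_eq, Equiv.Perm.iterate_eq_pow, hk]

theorem faceOf_out (f : Λ.Face) : faceOf Λ.rot (Quotient.out f.1) = f.1 := Quotient.out_eq f.1

variable [DecidableEq V]

/-- The mod 2 edge chain of the boundary walk of a face. -/
noncomputable def faceChain (f : Λ.Face) : G.edgeSet → ZMod 2 :=
  listChain (Λ.boundaryWalk (Quotient.out f.1))

open Classical in
theorem faceChain_dartEdge (f : Λ.Face) (d : G.Dart) : Λ.faceChain f (dartEdge d) =
    (if Λ.Beside d f then 1 else 0) + if Λ.Beside d.symm f then 1 else 0 := by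
  simp only [faceChain, listChain_dartEdge (Λ.nodup_boundaryWalk _), mem_boundaryWalk, faceOf_out]
  rfl

theorem faceChain_dartEdge_ne_zero {f : Λ.Face} {d : G.Dart} :
    Λ.faceChain f (dartEdge d) ≠ 0 ↔ Xor (Λ.Beside d f) (Λ.Beside d.symm f) := by
  classical
  rw [faceChain_dartEdge]
  by_cases h1 : Λ.Beside d f <;> by_cases h2 : Λ.Beside d.symm f <;>
    simp [h1, h2, Xor, CharTwo.add_self_eq_zero]

instance : Finite (FaceOf Λ.rot) :=
  Quotient.finite _

instance : Finite Λ.Face := by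
  unfold Face; infer_instance

theorem bdry_faceChain [Fintype G.edgeSet] (f : Λ.Face) : bdry G (Λ.faceChain f) = 0 := by
  obtain ⟨w, hw⟩ := Λ.exists_walk_darts_eq_boundaryWalk (Quotient.out f.1)
  rw [faceChain, ← hw, bdry_listChain_darts, ZModModule.add_self]

open Classical in
/-- The coefficient `t` of the face beside a dart (zero if that face is unbounded). -/
noncomputable def besideCoeff (t : Λ.Face → ZMod 2) (d : G.Dart) : ZMod 2 :=
  if h : Λ.IsUnbounded (faceOf Λ.rot d) then 0 else t ⟨faceOf Λ.rot d, h⟩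

theorem sum_faceChain_dartEdge [Fintype Λ.Face] (t : Λ.Face → ZMod 2) (d : G.Dart) :
    (∑ f, t f • Λ.faceChain f) (dartEdge d) = Λ.besideCoeff t d + Λ.besideCoeff t d.symm := by
  classical
  have key : ∀ d : G.Dart, (∑ f, t f * if Λ.Beside d f then 1 else 0) = Λ.besideCoeff t d := by
    intro d
    rw [besideCoeff]
    split_ifs with h
    · refine Finset.sum_eq_zero fun f _ => ?_
      rw [if_neg, mul_zero]
      intro hb
      exact f.2 (hb ▸ h)
    · rw [Finset.sum_eq_single ⟨faceOf Λ.rot d, h⟩]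
      · rw [if_pos (show Λ.Beside d ⟨faceOf Λ.rot d, h⟩ from rfl), mul_one]
      · intro f _ hf
        rw [if_neg, mul_zero]
        intro hb
        exact hf (Subtype.ext hb.symm)
      · exact fun hf => absurd (Finset.mem_univ _) hf
  rw [Finset.sum_apply, ← key, ← key, ← Finset.sum_add_distrib]
  refine Finset.sum_congr rfl fun f _ => ?_
  rw [Pi.smul_apply, faceChain_dartEdge, smul_eq_mul, mul_add]

/-- Vanishing of the sum says that the faces on the two sides of each edge have equal coefficients.
By connectedness all coefficients agree, and the unbounded face contributes 0. -/
theorem eq_zero_of_sum_faceChain_eq_zero [Fintype Λ.Face] (hG : G.Connected)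
    (t : Λ.Face → ZMod 2) (h : ∑ f, t f • Λ.faceChain f = 0) : t = 0 := by
  have hsymm : ∀ d, Λ.besideCoeff t d.symm = Λ.besideCoeff t d := fun d => by
    have := Λ.sum_faceChain_dartEdge t d
    rw [h] at this
    exact (CharTwo.add_eq_zero.1 this.symm).symm
  have hrot : ∀ d, Λ.besideCoeff t (Λ.rot d) = Λ.besideCoeff t d := fun d => by
    classical
    -- The face permutation sends `d.symm` to `rot d`, so rotating about a vertex amounts to
    -- crossing an edge.
    have : faceOf Λ.rot (Λ.rot d) = faceOf Λ.rot d.symm := faceOf_facePerm Λ.rot d.symm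
    rw [← hsymm d, besideCoeff, besideCoeff]
    exact congrArg (fun φ => if h : Λ.IsUnbounded φ then 0 else t ⟨φ, h⟩) this
  have hcyc : ∀ (n : ℕ) (d : G.Dart), Λ.besideCoeff t ((Λ.rot ^ n) d) = Λ.besideCoeff t d := by
    intro n
    induction n with
    | zero => simp
    | succ n ih => intro d; rw [pow_succ', Equiv.Perm.mul_apply, hrot, ih]
  have hfst : ∀ d d' : G.Dart, d.fst = d'.fst → Λ.besideCoeff t d = Λ.besideCoeff t d' := by
    intro d d' hd
    obtain ⟨n, hn⟩ := (Λ.sameCycle_rot d d' hd).exists_nat_pow_eq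
    rw [← hn, hcyc]
  have hconst : ∀ {x y : V} (_ : G.Walk x y) (d d' : G.Dart), d.fst = x → d'.fst = y →
      Λ.besideCoeff t d = Λ.besideCoeff t d' := by
    intro x y w
    induction w with
    | nil => exact fun d d' h1 h2 => hfst d d' (h1.trans h2.symm)
    | @cons a b c hab p ih =>
      intro d d' h1 h2
      let e : G.Dart := ⟨(a, b), hab⟩
      rw [hfst d e h1, ← hsymm e]
      exact ih e.symm d' rfl h2
  funext f
  obtain ⟨d, hd⟩ := exists_faceOf_eq f.1
  obtain ⟨g, hg, -⟩ := Λ.existsUnique_isUnbounded ⟨d⟩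
  obtain ⟨d', rfl⟩ := exists_faceOf_eq g
  obtain ⟨w⟩ := hG.preconnected d.fst d'.fst
  have h1 : Λ.besideCoeff t d = t f := by
    have hn : ¬ Λ.IsUnbounded (faceOf Λ.rot d) := hd ▸ f.2
    rw [besideCoeff, dif_neg hn]
    exact congrArg t (Subtype.ext hd)
  have h2 : Λ.besideCoeff t d' = 0 := by rw [besideCoeff, dif_pos hg]
  rw [← h1, hconst w d d' rfl rfl, h2]; rfl

theorem linearIndependent_faceChain (hG : G.Connected) :
    LinearIndependent (ZMod 2) Λ.faceChain := by
  have : Fintype Λ.Face := Fintype.ofFinite _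
  rw [Fintype.linearIndependent_iff]
  exact fun t ht f => congrFun (Λ.eq_zero_of_sum_faceChain_eq_zero hG t ht) f

/-- The independent face chains are cycles, and Euler's formula makes their number at least the
dimension of the cycle space. -/
theorem span_faceChain [Fintype G.edgeSet] (hG : G.Connected) :
    Submodule.span (ZMod 2) (Set.range Λ.faceChain) = LinearMap.ker (bdry G) := by
  have : Fintype Λ.Face := Fintype.ofFinite _
  refine Submodule.eq_of_le_of_finrank_le ?_ ?_
  · rw [Submodule.span_le]
    rintro _ ⟨f, rfl⟩
    exact Λ.bdry_faceChain f
  · rw [finrank_span_eq_card (Λ.linearIndependent_faceChain hG)]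
    have h1 := finrank_ker_bdry_add_le hG
    have h2 := Λ.euler
    rw [Nat.card_eq_fintype_card (α := G.edgeSet)] at h2
    have h3 : Nat.card {f // ¬ Λ.IsUnbounded f} = Fintype.card Λ.Face :=
      Nat.card_eq_fintype_card (α := Λ.Face)
    rw [h3] at h2
    omega

end PlaneEmbedding

end Faces


/-! ### Group rank as dimension over `ZMod 2`. -/

/-- Additive subgroups of a `ZMod 2`-module are submodules, so generating sets of `S` correspond
under the embedding to spanning sets of its image, and the rank is a dimension. -/
theorem rank_eq_card_of_linearIndependent {S W ι : Type*} [Group S] [Group.FG S] [AddCommGroup W]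
    [Module (ZMod 2) W] [Fintype ι] (φ : S →* Multiplicative W) (hφ : Function.Injective φ)
    (g : ι → S) (hli : LinearIndependent (ZMod 2) fun i => (φ (g i)).toAdd)
    (hspan : ∀ s, (φ s).toAdd ∈ Submodule.span (ZMod 2) (Set.range fun i => (φ (g i)).toAdd)) :
    Group.rank S = Fintype.card ι := by
  classical
  have sub : ∀ T : Set S, ∀ s : S,
      s ∈ Subgroup.closure T ↔
        (φ s).toAdd ∈ Submodule.span (ZMod 2) ((fun s => (φ s).toAdd) '' T) := by
    intro T s
    constructor
    · intro hs
      induction hs using Subgroup.closure_induction with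
      | mem x hx => exact Submodule.subset_span ⟨x, hx, rfl⟩
      | one => rw [map_one]; exact Submodule.zero_mem _
      | mul x y _ _ hx hy => rw [map_mul]; exact Submodule.add_mem _ hx hy
      | inv x _ hx => rw [map_inv]; exact Submodule.neg_mem _ hx
    · intro hs
      let N : Submodule (ZMod 2) W :=
        AddSubgroup.toZModSubmodule 2 (Subgroup.toAddSubgroup' ((Subgroup.closure T).map φ))
      have hN : Submodule.span (ZMod 2) ((fun s => (φ s).toAdd) '' T) ≤ N := by
        rw [Submodule.span_le]
        rintro _ ⟨x, hx, rfl⟩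
        exact ⟨x, Subgroup.subset_closure hx, rfl⟩
      obtain ⟨x, hx, hxs⟩ := hN hs
      exact hφ hxs ▸ hx
  apply le_antisymm
  · have htop : Subgroup.closure (Finset.univ.image g : Set S) = ⊤ := by
      refine eq_top_iff.2 fun s _ => (sub _ s).2 ?_
      rw [Finset.coe_image, Finset.coe_univ, Set.image_univ, ← Set.range_comp]
      exact hspan s
    exact (Group.rank_le htop).trans (Finset.card_image_le.trans_eq Finset.card_univ)
  · obtain ⟨T, hT, htop⟩ := Group.rank_spec S
    rw [← hT, ← finrank_span_eq_card hli]
    have h1 : Submodule.span (ZMod 2) (Set.range fun i => (φ (g i)).toAdd) ≤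
        Submodule.span (ZMod 2) (T.image fun s => (φ s).toAdd : Finset W) := by
      rw [Submodule.span_le]
      rintro _ ⟨i, rfl⟩
      rw [Finset.coe_image]
      exact (sub T (g i)).1 (htop ▸ Subgroup.mem_top _)
    exact (Submodule.finrank_mono h1).trans
      ((finrank_span_finset_le_card _).trans Finset.card_image_le)

/-! ### Relations in `M_G` and labels of its elements under an encoding. -/

section Group

variable {V : Type*} {G : SimpleGraph V}

theorem mk_eq_mk_of_rel {a b : FreeGroup (Gen G)} (h : Rel G a b) :
    (PresentedGroup.mk {r | ∃ a b, Rel G a b ∧ r = a * b⁻¹} a : MajoranaGroup G) =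
      PresentedGroup.mk _ b := by
  rw [← mul_inv_eq_one, ← map_inv, ← map_mul]
  exact PresentedGroup.one_of_mem ⟨a, b, h, rfl⟩

theorem gen_edge_symm (d : G.Dart) : (gen (.edge d) : MajoranaGroup G) =
    gen (.phase 2) * gen (.edge d.symm) :=
  mk_eq_mk_of_rel (.edge_symm d)

theorem gen_edge_mul_gen_edge {d d' : G.Dart} (h₁ : d.snd = d'.fst) (h₂ : d.fst ≠ d'.snd) :
    (gen (.edge d) * gen (.edge d') : MajoranaGroup G) =
      gen (.phase 2) * (gen (.edge d') * gen (.edge d)) :=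
  mk_eq_mk_of_rel (.edge_edge_anticomm d d' h₁ h₂)

theorem PlaneEmbedding.faceCycle_mem [Fintype V] (Λ : PlaneEmbedding G) (f : Λ.Face) :
    Λ.faceCycle f ∈ cycleGroup G := by
  obtain ⟨w, hw⟩ := Λ.exists_walk_darts_eq_boundaryWalk (Quotient.out f.1)
  exact Subgroup.subset_closure ⟨_, w, by rw [hw]; rfl⟩

end Group

namespace Encoding

variable {V : Type*} {G : SimpleGraph V} {Q : Type*} [Fintype Q] [DecidableEq Q]
  (ε : Encoding G Q)

/-- The symplectic coordinates of the operator representing an element of `M_G`. -/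
noncomputable def label (m : MajoranaGroup G) : PauliVec Q := pauliLabel (ε.σ m : QubitOp Q)

theorem label_mul (m n : MajoranaGroup G) : ε.label (m * n) = ε.label m + ε.label n := by
  rw [label, map_mul, Units.val_mul, pauliLabel_mul (ε.isPauliOp m) (ε.isPauliOp n)]; rfl

theorem label_phase (k : ZMod 4) : ε.label (gen (.phase k)) = 0 := by
  rw [label, ε.phase_op, pauliLabel_iPow_smul_one]

theorem label_one : ε.label 1 = 0 := by
  have := ε.label_mul 1 1
  rwa [mul_one, left_eq_add] at this

theorem label_inv (m : MajoranaGroup G) : ε.label m⁻¹ = -ε.label m := by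
  rw [eq_neg_iff_add_eq_zero, ← label_mul, inv_mul_cancel, label_one]

theorem label_edge_symm (d : G.Dart) :
    ε.label (gen (.edge d.symm)) = ε.label (gen (.edge d)) := by
  rw [gen_edge_symm d, label_mul, label_phase, zero_add]

/-- The symplectic coordinates of the operator representing an edge. -/
noncomputable def edgeLabel (e : G.edgeSet) : PauliVec Q :=
  ε.label (gen (.edge (exists_dartEdge_eq e).choose))

theorem edgeLabel_dartEdge (d : G.Dart) : ε.edgeLabel (dartEdge d) = ε.label (gen (.edge d)) := by
  rw [edgeLabel]
  rcases dartEdge_eq_iff.1 (exists_dartEdge_eq (dartEdge d)).choose_spec with h | h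
  · rw [h]
  · rw [h, label_edge_symm]

/-- Label zero leaves only a phase, and any phase other than 1 would put `-1` into the stabilizer
group. -/
theorem eq_one_of_label_eq_zero {m : MajoranaGroup G} (hm : m ∈ cycleGroup G)
    (h : ε.label m = 0) : ε.σ m = 1 := by
  obtain ⟨k, hk⟩ := (ε.isPauliOp m).exists_eq_smul_one h
  have hneg : ∀ n ∈ cycleGroup G, (ε.σ n : QubitOp Q) ≠ iPow 2 • 1 := fun n hn h2 =>
    ε.neg_one_notMem ⟨n, hn, Units.ext (by rw [h2, iPow_two]; simp)⟩
  have hsq : (ε.σ (m * m) : QubitOp Q) = iPow (k + k) • 1 := by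
    rw [map_mul, Units.val_mul, hk, smul_mul_smul_comm, ← iPow_add, one_mul]
  -- The last alternative covers the phases `±i`, where the square of `m` is the cycle mapped to
  -- `-1`.
  have hk' : ∀ k : ZMod 4, k = 0 ∨ k = 2 ∨ k + k = 2 := by decide
  rcases hk' k with rfl | rfl | h2
  · exact Units.ext (by rw [hk, iPow_zero, one_smul]; rfl)
  · exact absurd hk (hneg m hm)
  · rw [h2] at hsq
    exact absurd hsq (hneg _ (mul_mem hm hm))

theorem mem_kernel_iff {m : MajoranaGroup G} (hm : m ∈ cycleGroup G) :
    m ∈ ε.kernel ↔ ε.label m = 0 := by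
  refine ⟨fun h => ?_, fun h => ⟨hm, MonoidHom.mem_ker.2 (ε.eq_one_of_label_eq_zero hm h)⟩⟩
  rw [label, MonoidHom.mem_ker.1 h.2, ← map_one ε.σ]
  exact ε.label_one

/-- The symplectic coordinates of the elements of the stabilizer group. -/
noncomputable def stabilizerLabel : ε.stabilizer →* Multiplicative (PauliVec Q) where
  toFun s := Multiplicative.ofAdd (pauliLabel (s.1 : QubitOp Q))
  map_one' := congrArg Multiplicative.ofAdd ((congrArg (fun u : (QubitOp Q)ˣ =>
    pauliLabel (u : QubitOp Q)) (map_one ε.σ)).symm.trans ε.label_one)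
  map_mul' := by
    rintro ⟨_, m, hm, rfl⟩ ⟨_, n, hn, rfl⟩
    exact congrArg Multiplicative.ofAdd (pauliLabel_mul (ε.isPauliOp m) (ε.isPauliOp n))

theorem stabilizerLabel_injective : Function.Injective ε.stabilizerLabel := by
  rw [injective_iff_map_eq_one]
  rintro ⟨_, m, hm, rfl⟩ h
  exact Subtype.ext (ε.eq_one_of_label_eq_zero hm h)

/-- Otherwise the two operators would both commute and anticommute, although their product is
invertible. -/
theorem sum_qubitForm_label_ne_zero {d d' : G.Dart} (h₁ : d.snd = d'.fst) (h₂ : d.fst ≠ d'.snd) :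
    ∑ q, qubitForm (ε.label (gen (.edge d)) q) (ε.label (gen (.edge d')) q) ≠ 0 := by
  intro h
  have hc := (ε.isPauliOp _).mul_comm (ε.isPauliOp _) h
  have ha := congrArg (fun m => (ε.σ m : QubitOp Q)) (gen_edge_mul_gen_edge h₁ h₂)
  simp only [map_mul, Units.val_mul, ε.phase_op, iPow_two] at ha
  rw [hc, smul_mul_assoc, one_mul, neg_smul, one_smul, eq_neg_iff_add_eq_zero, ← two_smul ℂ,
    smul_eq_zero_iff_right two_ne_zero] at ha
  have hu := ((ε.σ (gen (.edge d'))) * (ε.σ (gen (.edge d)))).ne_zero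
  exact hu (by rw [Units.val_mul, ha])

variable [Fintype G.edgeSet]

/-- The symplectic coordinates of the products of edges, as a linear map on edge chains. -/
noncomputable def chainLabel : (G.edgeSet → ZMod 2) →ₗ[ZMod 2] PauliVec Q :=
  Fintype.linearCombination (ZMod 2) ε.edgeLabel

theorem chainLabel_apply (u : G.edgeSet → ZMod 2) (q : Q) :
    ε.chainLabel u q = ∑ e, u e • ε.edgeLabel e q := by
  rw [chainLabel, Fintype.linearCombination_apply, Finset.sum_apply]; rfl

variable [DecidableEq V]

theorem label_pathElt (l : List G.Dart) : ε.label (pathElt l) = ε.chainLabel (listChain l) := by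
  rw [pathElt, label_mul, label_phase, zero_add]
  induction l with
  | nil => simp [listChain, label_one]
  | cons d l ih =>
    rw [List.map_cons, List.prod_cons, label_mul, ih, listChain, listChain, List.map_cons,
      List.sum_cons, map_add, ← edgeLabel_dartEdge]
    congr 1
    rw [dartChain, chainLabel, Fintype.linearCombination_apply_single, one_smul]

theorem label_faceCycle [Fintype V] (Λ : PlaneEmbedding G) (f : Λ.Face) :
    ε.label (Λ.faceCycle f) = ε.chainLabel (Λ.faceChain f) :=
  ε.label_pathElt _

/-- The chain of a closed walk has no boundary, hence is a combination of face chains, and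
`chainLabel` is linear. -/
theorem label_mem_span [Fintype V] (hG : G.Connected) (Λ : PlaneEmbedding G)
    {m : MajoranaGroup G} (hm : m ∈ cycleGroup G) :
    ε.label m ∈ Submodule.span (ZMod 2) (Set.range fun f => ε.label (Λ.faceCycle f)) := by
  have hrange : (Set.range fun f => ε.label (Λ.faceCycle f)) =
      ε.chainLabel '' Set.range Λ.faceChain := by
    rw [← Set.range_comp]
    exact congrArg Set.range (funext fun f => ε.label_faceCycle Λ f)
  rw [hrange, Submodule.span_image, Λ.span_faceChain hG]
  induction hm using Subgroup.closure_induction with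
  | mem x hx =>
    obtain ⟨v, w, rfl⟩ := hx
    refine ⟨listChain w.darts, ?_, (ε.label_pathElt _).symm⟩
    rw [SetLike.mem_coe, LinearMap.mem_ker, bdry_listChain_darts, ZModModule.add_self]
  | one => rw [label_one]; exact Submodule.zero_mem _
  | mul x y _ _ hx hy => rw [label_mul]; exact Submodule.add_mem _ hx hy
  | inv x _ hx => rw [label_inv]; exact Submodule.neg_mem _ hx

end Encoding

/-! ### Splitting chains of label zero along the auxiliary qubits. -/

theorem card_filter_eq_zero_of_all_or_none {α : Type*} (s : Finset α) (p : α → Prop)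
    [DecidablePred p] (hp : ∀ x ∈ s, ∀ y ∈ s, p x → p y) (h : (s.card : ZMod 2) = 0) :
    ((s.filter p).card : ZMod 2) = 0 := by
  by_cases hx : ∃ x ∈ s, p x
  · obtain ⟨x, hxs, hx⟩ := hx
    rwa [Finset.filter_true_of_mem fun y hy => hp x hxs y hy hx]
  · push Not at hx
    rw [Finset.filter_false_of_mem hx]; simp

namespace Weight3PlanarEncoding

variable {V : Type*} [Fintype V] [DecidableEq V] {G : SimpleGraph V} {Λ : PlaneEmbedding G}
  {A : Type*} [Fintype A] [DecidableEq A] (ε : Weight3PlanarEncoding Λ A)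

theorem edgeLabel_inl_of_mem {e : G.edgeSet} {v : V} (hv : v ∈ e.1) :
    ε.edgeLabel e (.inl v) = (1, 0) ∨ ε.edgeLabel e (.inl v) = (1, 1) := by
  obtain ⟨d, rfl⟩ := exists_dartEdge_eq e
  obtain ⟨k, P, hP, h1, h2, -⟩ := ε.edge_op d
  rw [ε.edgeLabel_dartEdge, Encoding.label, hP, pauliLabel_smul]
  rcases mem_dartEdge.1 hv with rfl | rfl
  · exact h1.imp (congrArg Pauli.vec) (congrArg Pauli.vec)
  · exact h2.imp (congrArg Pauli.vec) (congrArg Pauli.vec)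

theorem edgeLabel_inl_of_notMem {e : G.edgeSet} {v : V} (hv : v ∉ e.1) :
    ε.edgeLabel e (.inl v) = 0 := by
  obtain ⟨d, rfl⟩ := exists_dartEdge_eq e
  obtain ⟨k, P, hP, -, -, h, -⟩ := ε.edge_op d
  rw [mem_dartEdge, not_or] at hv
  rw [ε.edgeLabel_dartEdge, Encoding.label, hP, pauliLabel_smul]
  exact Pauli.vec_eq_zero.2 (h v hv.1 hv.2)

theorem adjacent_of_edgeLabel_ne_zero {d : G.Dart} {a : A}
    (h : ε.edgeLabel (dartEdge d) (.inr a) ≠ 0) : Λ.Adjacent d (ε.face a) := by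
  obtain ⟨k, P, hP, -, -, -, h', -⟩ := ε.edge_op d
  rw [ε.edgeLabel_dartEdge, Encoding.label, hP, pauliLabel_smul] at h
  exact h' a (mt Pauli.vec_eq_zero.2 h)

theorem eq_of_edgeLabel_ne_zero {e : G.edgeSet} {a b : A}
    (ha : ε.edgeLabel e (.inr a) ≠ 0) (hb : ε.edgeLabel e (.inr b) ≠ 0) : a = b := by
  obtain ⟨d, rfl⟩ := exists_dartEdge_eq e
  obtain ⟨k, P, hP, -, -, -, -, h⟩ := ε.edge_op d
  rw [ε.edgeLabel_dartEdge, Encoding.label, hP, pauliLabel_smul] at ha hb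
  exact h a b (mt Pauli.vec_eq_zero.2 ha) (mt Pauli.vec_eq_zero.2 hb)

/-- The edges anticommute. Equal letters commute at `v`, and distinct edges of a simple graph share
no other vertex, so the sign must come from an auxiliary qubit. -/
theorem exists_common_auxiliary {e e' : G.edgeSet} (hne : e ≠ e') {v : V} (hv : v ∈ e.1)
    (hv' : v ∈ e'.1) (hl : ε.edgeLabel e (.inl v) = ε.edgeLabel e' (.inl v)) :
    ∃ a, ε.edgeLabel e (.inr a) ≠ 0 ∧ ε.edgeLabel e' (.inr a) ≠ 0 := by
  have hd : ∃ d : G.Dart, dartEdge d = e ∧ d.snd = v := by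
    obtain ⟨d, rfl⟩ := exists_dartEdge_eq e
    rcases mem_dartEdge.1 hv with h | h
    · exact ⟨d.symm, dartEdge_symm d, h.symm⟩
    · exact ⟨d, rfl, h.symm⟩
  have hd' : ∃ d : G.Dart, dartEdge d = e' ∧ d.fst = v := by
    obtain ⟨d, rfl⟩ := exists_dartEdge_eq e'
    rcases mem_dartEdge.1 hv' with h | h
    · exact ⟨d, rfl, h.symm⟩
    · exact ⟨d.symm, dartEdge_symm d, h.symm⟩
  obtain ⟨d, rfl, rfl⟩ := hd
  obtain ⟨d', rfl, hdd⟩ := hd'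
  have hends : d.fst ≠ d'.snd := fun h => hne (dartEdge_eq_iff.2 (Or.inr
    (SimpleGraph.Dart.ext _ _ (Prod.ext h hdd.symm))))
  have hsum := ε.sum_qubitForm_label_ne_zero hdd.symm hends
  rw [← ε.edgeLabel_dartEdge, ← ε.edgeLabel_dartEdge, Fintype.sum_sum_type,
    Finset.sum_eq_zero, zero_add] at hsum
  · obtain ⟨a, -, ha⟩ := Finset.exists_ne_zero_of_sum_ne_zero hsum
    exact ⟨a, fun h => ha (by simp [h, qubitForm]), fun h => ha (by simp [h, qubitForm])⟩
  · intro w _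
    by_cases hw : w = d.snd
    · subst hw
      rw [hl, qubitForm, mul_comm, CharTwo.add_self_eq_zero]
    · by_cases hwd : w ∈ (dartEdge d).1
      · rw [ε.edgeLabel_inl_of_notMem (e := dartEdge d')]
        · simp [qubitForm]
        · intro hwd'
          rw [mem_dartEdge] at hwd hwd'
          have h1 := hwd.resolve_right hw
          have h2 := hwd'.resolve_left (hdd ▸ hw)
          exact hends (h1.symm.trans h2)
      · rw [ε.edgeLabel_inl_of_notMem hwd]
        simp [qubitForm]

variable [Fintype G.edgeSet]

/-- Both `X` and `Y` have first coordinate 1, so this coordinate counts incident edges mod 2. Hence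
a chain of label zero is a cycle. -/
theorem fst_chainLabel_inl (u : G.edgeSet → ZMod 2) (v : V) :
    (ε.chainLabel u (.inl v)).1 = bdry G u v := by
  rw [ε.chainLabel_apply, Prod.fst_sum, bdry_apply]
  refine Finset.sum_congr rfl fun e _ => ?_
  rw [Prod.smul_fst, smul_eq_mul]
  split_ifs with hv
  · rcases ε.edgeLabel_inl_of_mem hv with h | h <;> rw [h]
  · rw [ε.edgeLabel_inl_of_notMem hv]; rfl

open Classical in
theorem chainLabel_inl (u : G.edgeSet → ZMod 2) (v : V) :
    ε.chainLabel u (.inl v) =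
      ((Finset.univ.filter fun e => u e ≠ 0 ∧ ε.edgeLabel e (.inl v) = (1, 0)).card : ZMod 2) •
        (1, 0) +
      ((Finset.univ.filter fun e => u e ≠ 0 ∧ ε.edgeLabel e (.inl v) = (1, 1)).card : ZMod 2) •
        (1, 1) := by
  rw [ε.chainLabel_apply, Finset.card_filter, Finset.card_filter, Nat.cast_sum, Nat.cast_sum,
    Finset.sum_smul, Finset.sum_smul, ← Finset.sum_add_distrib]
  refine Finset.sum_congr rfl fun e _ => ?_
  by_cases hu : u e = 0
  · simp [hu]
  · rw [ZMod.eq_one_of_ne_zero hu]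
    by_cases hv : v ∈ e.1
    · rcases ε.edgeLabel_inl_of_mem hv with h | h <;> simp [h]
    · simp [ε.edgeLabel_inl_of_notMem hv, Prod.ext_iff]

open Classical in
/-- The part of an edge chain on the edges that act on the auxiliary qubit `a`. -/
noncomputable def auxPart (u : G.edgeSet → ZMod 2) (a : A) : G.edgeSet → ZMod 2 :=
  fun e => if ε.edgeLabel e (.inr a) ≠ 0 then u e else 0

section ChainLabelZero

variable {ε} {c : G.edgeSet → ZMod 2}

open Classical in
-- The vectors of `X` and `Y` are linearly independent, so each letter occurs an even number of
-- times at `v`.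
theorem card_letter_eq_zero (hc : ε.chainLabel c = 0) {v : V} {l : ZMod 2 × ZMod 2}
    (hl : l = (1, 0) ∨ l = (1, 1)) :
    ((Finset.univ.filter fun e => c e ≠ 0 ∧ ε.edgeLabel e (.inl v) = l).card : ZMod 2) = 0 := by
  have h := ε.chainLabel_inl c v
  rw [hc] at h
  have h2 := congrArg Prod.snd h
  have h1 := congrArg Prod.fst h
  simp only [Pi.zero_apply, Prod.fst_zero, Prod.snd_zero, Prod.fst_add, Prod.snd_add,
    Prod.smul_fst, Prod.smul_snd, smul_eq_mul, mul_one, mul_zero, zero_add] at h1 h2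
  rw [← h2, add_zero] at h1
  rcases hl with rfl | rfl
  · exact h1.symm
  · exact h2.symm

/-- Edges with the same letter at `v` pairwise share an auxiliary qubit, and each edge acts on at
most one. So either all or none of them act on `a`, and the even letter counts survive the
restriction. -/
theorem chainLabel_auxPart (hc : ε.chainLabel c = 0) (a : A) : ε.chainLabel (ε.auxPart c a) = 0 := by
  classical
  funext q
  rcases q with v | b
  · rw [ε.chainLabel_inl]
    have key : ∀ l : ZMod 2 × ZMod 2, l = (1, 0) ∨ l = (1, 1) →
        ((Finset.univ.filter fun e => ε.auxPart c a e ≠ 0 ∧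
          ε.edgeLabel e (.inl v) = l).card : ZMod 2) = 0 := by
      intro l hl
      have hfil : (Finset.univ.filter fun e => ε.auxPart c a e ≠ 0 ∧
          ε.edgeLabel e (.inl v) = l) = (Finset.univ.filter fun e => c e ≠ 0 ∧
          ε.edgeLabel e (.inl v) = l).filter fun e => ε.edgeLabel e (.inr a) ≠ 0 := by
        ext e
        simp only [auxPart, Finset.mem_filter, Finset.mem_univ, true_and, ne_eq, ite_not,
          ite_eq_left_iff]
        tauto
      have hl0 : l ≠ 0 := by rcases hl with rfl | rfl <;> decide
      rw [hfil]
      refine card_filter_eq_zero_of_all_or_none _ _ ?_ (card_letter_eq_zero hc hl)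
      intro x hx y hy hxa
      simp only [Finset.mem_filter, Finset.mem_univ, true_and] at hx hy
      by_cases hxy : x = y
      · rwa [← hxy]
      · have hmem : ∀ z : G.edgeSet, ε.edgeLabel z (.inl v) = l → v ∈ z.1 := fun z hz =>
          by_contra fun hn => hl0 (hz ▸ ε.edgeLabel_inl_of_notMem hn)
        obtain ⟨b, hxb, hyb⟩ := ε.exists_common_auxiliary hxy (hmem x hx.2) (hmem y hy.2)
          (hx.2.trans hy.2.symm)
        rwa [ε.eq_of_edgeLabel_ne_zero hxa hxb]
    rw [key _ (.inl rfl), key _ (.inr rfl), zero_smul, zero_smul, add_zero]; rfl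
  · rw [ε.chainLabel_apply]
    by_cases hab : a = b
    · subst hab
      have := congrFun hc (.inr a)
      rw [ε.chainLabel_apply] at this
      rw [← this]
      refine Finset.sum_congr rfl fun e _ => ?_
      rw [auxPart]
      split_ifs with h
      · rfl
      · rw [not_not.1 h, smul_zero, smul_zero]
    · refine Finset.sum_eq_zero fun e _ => ?_
      rw [auxPart]
      split_ifs with h
      · have h0 : ε.edgeLabel e (.inr b) = 0 :=
          by_contra fun h' => hab (ε.eq_of_edgeLabel_ne_zero h h')
        rw [h0, smul_zero]
      · rw [zero_smul]

/-- By parity, `e` is not alone with its letter at an endpoint; it shares an auxiliary qubit with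
its companion. -/
theorem exists_auxiliary_of_ne_zero (hc : ε.chainLabel c = 0) {e : G.edgeSet} (he : c e ≠ 0) :
    ∃ a, ε.edgeLabel e (.inr a) ≠ 0 := by
  classical
  obtain ⟨d, rfl⟩ := exists_dartEdge_eq e
  have hv : d.fst ∈ (dartEdge d).1 := mem_dartEdge.2 (Or.inl rfl)
  have hl := ε.edgeLabel_inl_of_mem hv
  have hcard := card_letter_eq_zero hc (v := d.fst) hl
  by_contra! hno
  have hs : (Finset.univ.filter fun e => c e ≠ 0 ∧
      ε.edgeLabel e (.inl d.fst) = ε.edgeLabel (dartEdge d) (.inl d.fst)) = {dartEdge d} := by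
    ext x
    simp only [Finset.mem_filter, Finset.mem_univ, true_and, Finset.mem_singleton]
    refine ⟨fun hx => ?_, fun hx => by rw [hx]; exact ⟨he, rfl⟩⟩
    by_contra hne
    have hxv : d.fst ∈ x.1 := by
      by_contra hn
      rw [ε.edgeLabel_inl_of_notMem hn] at hx
      rcases hl with h | h <;> exact absurd (hx.2.trans h) (by decide)
    obtain ⟨a, -, ha⟩ := ε.exists_common_auxiliary hne hxv hv hx.2
    exact ha (hno a)
  rw [hs, Finset.card_singleton] at hcard
  exact absurd hcard (by decide)

theorem sum_auxPart (hc : ε.chainLabel c = 0) : ∑ a, ε.auxPart c a = c := by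
  funext e
  rw [Finset.sum_apply]
  by_cases he : c e = 0
  · rw [he]
    exact Finset.sum_eq_zero fun a _ => by rw [auxPart, he, ite_self]
  · obtain ⟨a, ha⟩ := exists_auxiliary_of_ne_zero hc he
    rw [Finset.sum_eq_single a]
    · rw [auxPart, if_pos ha]
    · intro b _ hb
      rw [auxPart, if_neg]
      exact fun h => hb (ε.eq_of_edgeLabel_ne_zero h ha)
    · simp

end ChainLabelZero

/-- Any relation among the labels of face cycles involves only face cycles whose labels vanish
individually. This is the step that needs the auxiliary faces to be bounded by cycles. -/
theorem label_faceCycle_eq_zero [Fintype Λ.Face] (hG : G.Connected)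
    (hface : ∀ a, Λ.BoundedByCycle (ε.face a)) (t : Λ.Face → ZMod 2)
    (ht : ∑ f, t f • ε.label (Λ.faceCycle f) = 0) (f : Λ.Face) (hf : t f ≠ 0) :
    ε.label (Λ.faceCycle f) = 0 := by
  classical
  set c : G.edgeSet → ZMod 2 := ∑ f, t f • Λ.faceChain f with hcdef
  have hc : ε.chainLabel c = 0 := by
    rw [hcdef, map_sum, ← ht]
    exact Finset.sum_congr rfl fun f _ => by rw [map_smul, ε.label_faceCycle]
  have hmul : ∀ a, ∃ s : ZMod 2, ε.auxPart c a = s • Λ.faceChain (ε.face a) := by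
    intro a
    obtain ⟨v, p, hp, hpe⟩ := hface a
    refine exists_eq_smul_of_support_cycle p hp ?_ ?_ ?_ (Λ.bdry_faceChain _)
    · intro e he
      obtain ⟨d, rfl⟩ := exists_dartEdge_eq e
      have h1 : ε.edgeLabel (dartEdge d) (.inr a) ≠ 0 := fun h => he (by simp [auxPart, h])
      have h2 : c (dartEdge d) ≠ 0 := fun h => he (by simp [auxPart, h])
      rw [hcdef, Λ.sum_faceChain_dartEdge] at h2
      refine (hpe d).2 ?_
      -- Adjacency alone allows the face on both sides of the edge, but such an edge gets its
      -- coefficient twice and drops out of `c`.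
      have hnot : ¬ (Λ.Beside d (ε.face a) ∧ Λ.Beside d.symm (ε.face a)) := by
        rintro ⟨hb, hb'⟩
        apply h2
        have heq : faceOf Λ.rot d = faceOf Λ.rot d.symm := hb.trans hb'.symm
        have : Λ.besideCoeff t d = Λ.besideCoeff t d.symm :=
          congrArg (fun φ => if h : Λ.IsUnbounded φ then 0 else t ⟨φ, h⟩) heq
        rw [this, CharTwo.add_self_eq_zero]
      have hor := ε.adjacent_of_edgeLabel_ne_zero h1
      unfold PlaneEmbedding.Adjacent at hor
      unfold Xor
      tauto
    · intro e
      obtain ⟨d, rfl⟩ := exists_dartEdge_eq e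
      rw [Λ.faceChain_dartEdge_ne_zero]
      exact (hpe d).symm
    · funext v
      rw [← ε.fst_chainLabel_inl, chainLabel_auxPart hc]; rfl
  choose s hs using hmul
  have hsum : ∑ f, (t f - ∑ a, if ε.face a = f then s a else 0) • Λ.faceChain f = 0 := by
    simp only [sub_smul, Finset.sum_sub_distrib, Finset.sum_smul]
    rw [← hcdef, Finset.sum_comm, sub_eq_zero]
    conv_lhs => rw [← sum_auxPart hc]
    refine Finset.sum_congr rfl fun a _ => ?_
    rw [hs, Finset.sum_eq_single (ε.face a)]
    · rw [if_pos rfl]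
    · intro g _ hg
      rw [if_neg hg.symm, zero_smul]
    · simp
  -- Comparing coefficients, a nonzero `t f` forces `f` to be the face of some `a` with `s a = 1`,
  -- whose face chain is then a part of `c`.
  have htf := congrFun (Λ.eq_zero_of_sum_faceChain_eq_zero hG _ hsum) f
  rw [sub_eq_zero.1 htf] at hf
  obtain ⟨a, -, ha⟩ := Finset.exists_ne_zero_of_sum_ne_zero hf
  rw [ite_ne_right_iff] at ha
  obtain ⟨rfl, hsa⟩ := ha
  have := hs a
  rw [ZMod.eq_one_of_ne_zero hsa, one_smul] at this
  rw [ε.label_faceCycle, ← this, chainLabel_auxPart hc]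

theorem rank_stabilizer (hG : G.Connected) (hface : ∀ a, Λ.BoundedByCycle (ε.face a)) :
    Group.rank ε.stabilizer = Nat.card {f : Λ.Face // Λ.faceCycle f ∉ ε.kernel} := by
  classical
  have : Fintype Λ.Face := Fintype.ofFinite _
  rw [Nat.card_eq_fintype_card]
  have hker : ∀ f, Λ.faceCycle f ∈ ε.kernel ↔ ε.label (Λ.faceCycle f) = 0 := fun f =>
    ε.mem_kernel_iff (Λ.faceCycle_mem f)
  refine rank_eq_card_of_linearIndependent ε.stabilizerLabel ε.stabilizerLabel_injective
    (fun f => ⟨ε.σ (Λ.faceCycle f.1), Λ.faceCycle f.1, Λ.faceCycle_mem f.1, rfl⟩) ?_ ?_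
  · change LinearIndependent (ZMod 2)
      fun f : {f : Λ.Face // Λ.faceCycle f ∉ ε.kernel} => ε.label (Λ.faceCycle f.1)
    rw [Fintype.linearIndependent_iff]
    intro t ht f
    by_contra hf
    -- Extension by zero turns a relation among the faces outside `K` into one among all faces.
    let t' : Λ.Face → ZMod 2 := fun g => if h : Λ.faceCycle g ∉ ε.kernel then t ⟨g, h⟩ else 0
    have ht' : ∑ g, t' g • ε.label (Λ.faceCycle g) = 0 := by
      rw [← ht]
      refine (Fintype.sum_of_injective Subtype.val Subtype.val_injective _ _ ?_ ?_).symm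
      · intro g hg
        rw [Subtype.range_coe_subtype, Set.mem_ofPred_eq, not_not] at hg
        simp [(hker g).1 hg]
      · intro g
        simp [t', g.2]
    refine f.2 ((hker _).2 (ε.label_faceCycle_eq_zero hG hface t' ht' f.1 ?_))
    simp only [t', dif_pos f.2]
    exact hf
  · rintro ⟨_, m, hm, rfl⟩
    refine Submodule.span_le.2 ?_ (ε.label_mem_span hG Λ hm)
    rintro _ ⟨f, rfl⟩
    by_cases hf : ε.label (Λ.faceCycle f) = 0
    · change ε.label (Λ.faceCycle f) ∈ _
      rw [hf]; exact Submodule.zero_mem _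
    · exact Submodule.subset_span ⟨⟨f, mt (hker f).1 hf⟩, rfl⟩

end Weight3PlanarEncoding

end FermionicEncoding

/-! ### Counting faces and qubits. -/

theorem mainTheorem5 {V A : Type*} [Fintype V] [DecidableEq V] [Fintype A] [DecidableEq A]
    (G : SimpleGraph V) (hG : G.Connected) (Λ : FermionicEncoding.PlaneEmbedding G)
    (ε : FermionicEncoding.Weight3PlanarEncoding Λ A)
    (hface : ∀ a : A, Λ.BoundedByCycle (ε.face a)) :
    ε.disparity = (ε.numFaceCyclesInKernel : ℤ) - (ε.numEmptyFaces : ℤ) := by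
  classical
  have : Fintype G.edgeSet := Fintype.ofFinite _
  have : Fintype Λ.Face := Fintype.ofFinite _
  have hrank := ε.rank_stabilizer hG hface
  have hK := Fintype.card_subtype_compl fun f : Λ.Face => Λ.faceCycle f ∈ ε.kernel
  have hK' := Fintype.card_subtype_le fun f : Λ.Face => Λ.faceCycle f ∈ ε.kernel
  have hE := Fintype.card_subtype_compl fun f : Λ.Face => f ∈ Set.range ε.face
  have hE' := Fintype.card_subtype_le fun f : Λ.Face => f ∈ Set.range ε.face
  -- Here `N - M` is the number of auxiliary qubits, that is, of occupied faces.
  have hA : Fintype.card {f : Λ.Face // f ∈ Set.range ε.face} = Fintype.card A :=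
    (Fintype.card_congr (Equiv.ofInjective ε.face ε.face_injective)).symm
  rw [FermionicEncoding.Encoding.disparity, hrank,
    FermionicEncoding.Weight3PlanarEncoding.numFaceCyclesInKernel,
    FermionicEncoding.Weight3PlanarEncoding.numEmptyFaces, Nat.card_eq_fintype_card,
    Nat.card_eq_fintype_card, Nat.card_eq_fintype_card, Fintype.card_sum]
  push_cast
  omega
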